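/- Let $\mathbb{H}^3$ be hyperbolic 3-space (curvature $-1$), let $\hat{\mathbb{C}}=\partial_\infty\mathbb{H}^3$ be the sphere at infinity, let $\gamma\subset\hat{\mathbb{C}}$ be a Jordan curve and let $\Omega$ be a connected component of $\hat{\mathbb{C}}\smallsetminus\gamma$. Let $\rho_\Omega$ be the Poincaré metric of $\Omega$, i.e. the conformal metric whose pull-back by a conformal map $f:\mathbb{D}\to\Omega$ of the unit disk onto $\Omega$ is $4|d\zeta|^2/(1-|\zeta|^2)^2$. For $x\in\mathbb{H}^3$ let $\nu_x$ be the visual metric from $x$ (the pull-back of the round metric of the sphere by an isometry of the ball model that sends $x$ to the origin). For a conformal metric $\rho$ on $\Omega$ and $z\in\Omega$, the set $\mathfrak{H}(z,\rho)=\{x\in\mathbb{H}^3:\nu_x(z)=\rho(z)\}$ is a horosphere based at $z$. The Epstein map $\mathrm{Ep}_\rho:\Omega\to\mathbb{H}^3$ of a smooth $\rho$ is the unique smooth map such that, for every $z\in\Omega$, the point $\mathrm{Ep}_\rho(z)$ lies on $\mathfrak{H}(z,\rho)$ and the image of the differential of $\mathrm{Ep}_\rho$ at $z$ is orthogonal to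 the outward normal of $\mathfrak{H}(z,\rho)$ at $\mathrm{Ep}_\rho(z)$. For $t\in\mathbb{R}$ let $\Sigma_\Omega(t)$ be the image of $\mathrm{Ep}_{e^{2t}\rho_\Omega}$. Let $M\subset\mathbb{H}^3$ be a properly embedded minimal surface without boundary whose ideal boundary (its set of accumulation points in $\hat{\mathbb{C}}$) is $\partial_\infty M=\gamma$, and let $M_\Omega$ be the closure in $\mathbb{H}^3$ of the connected component of $\mathbb{H}^3\smallsetminus M$ whose ideal boundary contains $\Omega$. Assume that at every point of $M$ the principal curvatures of $M$ lie strictly between $-1$ and $1$. Then $\Sigma_\Omega(t)\subset M_\Omega$ for every $t\ge 0$. -/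

import Mathlib

open Metric Set
open scoped Manifold ContDiff Topology

noncomputable section

namespace EpsteinPoincare

/-- Euclidean 3-space, containing the ball model of hyperbolic 3-space. -/
abbrev E3 : Type := EuclideanSpace ℝ (Fin 3)

/-- The parameter plane of surfaces. -/
abbrev E2 : Type := EuclideanSpace ℝ (Fin 2)

/-- The sphere at infinity (the Riemann sphere), with its round metric. -/
abbrev S2 : Type := sphere (0 : E3) 1

/-- Hyperbolic 3-space, in the ball model. -/
def H3 : Set E3 := ball 0 1

/-- The hyperbolic metric `4 |dx|² / (1 - |x|²)²`, evaluated on two tangent vectors at `x`. -/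
def hypMetric (x v w : E3) : ℝ := 4 / (1 - ‖x‖ ^ 2) ^ 2 * inner ℝ v w

/-- The Christoffel symbols `Γ_x(v, w)` of the Levi-Civita connection of the hyperbolic metric, so
that `∇_V W = D_V W + Γ(V, W)`.  The metric is `e^{2u} |dx|²` with `u = log 2 - log (1 - |x|²)`,
whence `Γ(v, w) = du(v) w + du(w) v - ⟨v, w⟩ grad u` and `grad u = 2 x / (1 - |x|²)`. -/
def christoffel (x v w : E3) : E3 :=
  (2 / (1 - ‖x‖ ^ 2)) • (inner ℝ x v • w + inner ℝ x w • v - inner ℝ v w • x)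

/-- The set of accumulation points on the sphere at infinity of a subset of hyperbolic space. -/
def idealBoundary (A : Set E3) : Set S2 := {z | (z : E3) ∈ closure A}

/-! ### Surfaces and their curvatures -/

/-- `X : U → M` is a local parametrization (of class `C²`) of the subset `M` of space: `U` is open,
`X` is an immersion and a homeomorphism from `U` onto a relatively open subset of `M`. -/
structure IsLocalParametrization (M : Set E3) (U : Set E2) (X : E2 → E3) : Prop where
  isOpen_domain : IsOpen U
  contDiffOn : ContDiffOn ℝ 2 X U
  immersion : ∀ u ∈ U, Function.Injective (fderiv ℝ X u)
  isEmbedding : Topology.IsEmbedding (U.domRestrict X)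
  image_eq : ∃ W : Set E3, IsOpen W ∧ X '' U = M ∩ W

/-- The coordinate vector field `∂ᵢX`. -/
def coordField (X : E2 → E3) (i : Fin 2) (u : E2) : E3 :=
  fderiv ℝ X u (EuclideanSpace.single i 1)

/-- `N` is a unit normal vector, for the hyperbolic metric, of the parametrized surface `X`
at `X u`. -/
def IsUnitNormal (X : E2 → E3) (u : E2) (N : E3) : Prop :=
  hypMetric (X u) N N = 1 ∧ ∀ v : E2, hypMetric (X u) (fderiv ℝ X u v) N = 0

/-- The matrix `g(∂ᵢX, ∂ⱼX)` of the first fundamental form. -/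
def firstForm (X : E2 → E3) (u : E2) : Matrix (Fin 2) (Fin 2) ℝ :=
  Matrix.of fun i j => hypMetric (X u) (coordField X i u) (coordField X j u)

/-- The matrix `g(∇_{∂ᵢX} ∂ⱼX, N)` of the second fundamental form. -/
def secondForm (X : E2 → E3) (u : E2) (N : E3) : Matrix (Fin 2) (Fin 2) ℝ :=
  Matrix.of fun i j =>
    hypMetric (X u)
      (fderiv ℝ (coordField X j) u (EuclideanSpace.single i 1) +
        christoffel (X u) (coordField X i u) (coordField X j u)) N

/-- The matrix of the shape operator in the basis `∂₁X, ∂₂X` of the tangent plane. -/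
def shapeOperator (X : E2 → E3) (u : E2) (N : E3) : Matrix (Fin 2) (Fin 2) ℝ :=
  (firstForm X u)⁻¹ * secondForm X u N

/-- The mean curvature, half the trace of the shape operator. -/
def meanCurvature (X : E2 → E3) (u : E2) (N : E3) : ℝ := (shapeOperator X u N).trace / 2

/-- `k` is a principal curvature of the surface `M` at `p` (for one of the two unit normals at `p`):
an eigenvalue of the shape operator. -/
def IsPrincipalCurvature (M : Set E3) (p : E3) (k : ℝ) : Prop :=
  ∃ (U : Set E2) (X : E2 → E3) (u : E2) (N : E3),
    IsLocalParametrization M U X ∧ u ∈ U ∧ X u = p ∧ IsUnitNormal X u N ∧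
      Module.End.HasEigenvalue (Matrix.toLin' (shapeOperator X u N)) k

/-- Properly embedded minimal surfaces (without boundary) in hyperbolic 3-space. -/
structure IsMinimalSurface (M : Set E3) : Prop where
  subset : M ⊆ H3
  closed : closure M ∩ H3 ⊆ M
  exists_param : ∀ p ∈ M, ∃ (U : Set E2) (X : E2 → E3), IsLocalParametrization M U X ∧ p ∈ X '' U
  minimal : ∀ (U : Set E2) (X : E2 → E3), IsLocalParametrization M U X →
    ∀ u ∈ U, ∀ N : E3, IsUnitNormal X u N → meanCurvature X u N = 0

/-! ### Conformal metrics and Epstein maps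

A conformal metric on a domain of the sphere is given by the function `ρ` for which it equals
`ρ` times the round metric. -/

/-- The visual metric from the point `x` of hyperbolic space.  An isometry taking `x` to the origin
acts on the sphere with conformal factor `(1 - |x|²) / |x - z|²` at `z`, so this is the pull-back of
the round metric. -/
def visualMetric (x : E3) (z : S2) : ℝ := ((1 - ‖x‖ ^ 2) / ‖x - (z : E3)‖ ^ 2) ^ 2

/-- The horosphere based at `z` on which the visual metric takes the value `c` at `z`. -/
def horosphere (z : S2) (c : ℝ) : Set E3 := {x | x ∈ H3 ∧ visualMetric x z = c}

/-- The unit normal at `x`, pointing away from `z`, of the horosphere based at `z` through `x`: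
minus the gradient (for the hyperbolic metric) of
`x ↦ log ((1 - |x|²) / |x - z|²)`, a function with gradient of length one. -/
def outwardNormal (z : S2) (x : E3) : E3 :=
  ((1 - ‖x‖ ^ 2) / 2) • x +
    ((1 - ‖x‖ ^ 2) ^ 2 / (2 * ‖x - (z : E3)‖ ^ 2)) • (x - (z : E3))

/-- `Ep` is the Epstein map of the conformal metric `ρ` on `Ω`: the smooth solution of the envelope
equation of the horospheres determined by `ρ`. -/
structure IsEpsteinMap (Ω : Set S2) (ρ : S2 → ℝ) (Ep : S2 → E3) : Prop where
  smooth : ContMDiffOn (𝓡 2) 𝓘(ℝ, E3) ∞ Ep Ω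
  mem_horosphere : ∀ z ∈ Ω, Ep z ∈ horosphere z (ρ z)
  envelope : ∀ z ∈ Ω, ∀ v : TangentSpace (𝓡 2) z,
    hypMetric (Ep z) (mfderiv (𝓡 2) 𝓘(ℝ, E3) Ep z v) (outwardNormal z (Ep z)) = 0

/-- `ρ` is the Poincaré metric of the simply connected domain `Ω`: its pull-back by a conformal
map `f` from the unit disk onto `Ω` is `4 |dζ|² / (1 - |ζ|²)²`, the complete conformal metric of
curvature `-1` on the disk. -/
def IsPoincareMetric (Ω : Set S2) (ρ : S2 → ℝ) : Prop :=
  ∃ f : ℂ → S2,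
    ContDiffOn ℝ ∞ (fun ζ => (f ζ : E3)) (ball 0 1) ∧
    InjOn f (ball 0 1) ∧ f '' ball 0 1 = Ω ∧
    ∀ ζ ∈ ball (0 : ℂ) 1,
      ConformalAt (fun ζ => (f ζ : E3)) ζ ∧
      ρ (f ζ) * ‖fderiv ℝ (fun ζ => (f ζ : E3)) ζ‖ ^ 2 = 4 / (1 - ‖ζ‖ ^ 2) ^ 2

/-- The surface `Σ_Ω(t)`, the image of the Epstein map of `e^{2t} ρ_Ω`, where `ρ_Ω` is the
Poincaré metric of `Ω`. -/
def epsteinPoincareSurface (Ω : Set S2) (t : ℝ) : Set E3 :=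
  {x | ∃ (ρ : S2 → ℝ) (Ep : S2 → E3), IsPoincareMetric Ω ρ ∧
    IsEpsteinMap Ω (fun z => Real.exp (2 * t) * ρ z) Ep ∧ x ∈ Ep '' Ω}

/-! ### Jordan curves and components -/

/-- Jordan curves on the sphere. -/
def IsJordanCurve (γ : Set S2) : Prop :=
  ∃ c : Circle → S2, Continuous c ∧ Function.Injective c ∧ range c = γ

/-- `C` is a connected component of the subset `A`. -/
def IsComponentOf {T : Type*} [TopologicalSpace T] (C A : Set T) : Prop :=
  ∃ x ∈ A, C = connectedComponentIn A x

end EpsteinPoincare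

end

/-! The core is the inequality `ν_x ≤ ρ_Ω` on `Ω` for every `x ∈ M`
(`visualMetric_le_of_isPoincareMetric`). Granted it, a point `y = Ep z` of `Σ_Ω(t)` lies on the
horosphere at `z` of level `e^{2t} ρ_Ω(z) ≥ ρ_Ω(z)`, so `M` avoids the open horoball bounded by it.
The segment from `y` to `z` runs inside this horoball and ends near `z`, where the complement of `M`
belongs to `C`; hence `y ∈ closure C` (`mem_closure_of_visualMetric_le`).

The inequality is an Ahlfors–Schwarz lemma in which `x` moves as well. Let `F : 𝔻 → Ω` be conformal
with factor `l`, and for `r < 1` compare `σ = l(ζ) ν_x(F ζ)` with the Poincaré density `4r²/(r² -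
|ζ|²)²`. Their ratio is continuous on the compact set `closure M × closedBall 0 r` and vanishes
where `|x| = 1` or `|ζ| = r`, so its maximum is an interior one. There the first variation in `x`
makes `M` tangent to the horosphere at `F ζ`. For the second variation (`contact_inequality`), `ζ`
moves along `1` and `i` while `x` moves along two orthogonal tangent vectors of equal length. The
second fundamental form then enters only through its trace, which is zero; with `ΔF = -2lF` and
Liouville's equation for `l`, the sum becomes `2(σ - 4r²/(r² - |ζ|²)²) ≤ 0`. Finally `r → 1`. -/

namespace EpsteinPoincare

/-! ### Two-jets of curves -/

section Jet

variable {E : Type*} [NormedAddCommGroup E] [NormedSpace ℝ E]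

/-- The curve `p` is twice differentiable at `0`, with value `a`, velocity `b` and
acceleration `c` there. -/
def HasTwoJet (p : ℝ → E) (a b c : E) : Prop :=
  p 0 = a ∧ ∃ p' : ℝ → E, (∀ᶠ s in 𝓝 0, HasDerivAt p (p' s) s) ∧ p' 0 = b ∧ HasDerivAt p' c 0

theorem HasTwoJet.congr {p : ℝ → E} {a b c a' b' c' : E} (h : HasTwoJet p a b c)
    (ha : a = a') (hb : b = b') (hc : c = c') : HasTwoJet p a' b' c' := by
  subst ha hb hc; exact h

theorem hasTwoJet_const (a : E) : HasTwoJet (fun _ => a) a 0 0 :=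
  ⟨rfl, fun _ => 0, .of_forall fun s => hasDerivAt_const s a, rfl, hasDerivAt_const _ _⟩

theorem HasTwoJet.add {p q : ℝ → E} {a b c a' b' c' : E} (hp : HasTwoJet p a b c)
    (hq : HasTwoJet q a' b' c') :
    HasTwoJet (fun s => p s + q s) (a + a') (b + b') (c + c') := by
  obtain ⟨h0, p', h1, h2, h3⟩ := hp
  obtain ⟨k0, q', k1, k2, k3⟩ := hq
  refine ⟨by simp only [h0, k0], fun s => p' s + q' s, ?_, by simp only [h2, k2], h3.add k3⟩
  filter_upwards [h1, k1] with s hs ks using hs.add ks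

theorem HasTwoJet.const_smul {p : ℝ → E} {a b c : E} (k : ℝ) (hp : HasTwoJet p a b c) :
    HasTwoJet (fun s => k • p s) (k • a) (k • b) (k • c) := by
  obtain ⟨h0, p', h1, h2, h3⟩ := hp
  refine ⟨by simp only [h0], fun s => k • p' s, ?_, by simp only [h2], h3.const_smul k⟩
  filter_upwards [h1] with s hs using hs.const_smul k

theorem HasTwoJet.sub {p q : ℝ → E} {a b c a' b' c' : E} (hp : HasTwoJet p a b c)
    (hq : HasTwoJet q a' b' c') :
    HasTwoJet (fun s => p s - q s) (a - a') (b - b') (c - c') := by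
  obtain ⟨h0, p', h1, h2, h3⟩ := hp
  obtain ⟨k0, q', k1, k2, k3⟩ := hq
  refine ⟨by simp only [h0, k0], fun s => p' s - q' s, ?_, by simp only [h2, k2], h3.sub k3⟩
  filter_upwards [h1, k1] with s hs ks using hs.sub ks

theorem HasTwoJet.real_inner {F : Type*} [NormedAddCommGroup F] [InnerProductSpace ℝ F]
    {p q : ℝ → F} {a b c a' b' c' : F} (hp : HasTwoJet p a b c)
    (hq : HasTwoJet q a' b' c') :
    HasTwoJet (fun s => inner ℝ (p s) (q s)) (inner ℝ a a') (inner ℝ a b' + inner ℝ b a')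
      (inner ℝ a c' + 2 * inner ℝ b b' + inner ℝ c a') := by
  obtain ⟨rfl, p', h1, rfl, h3⟩ := hp
  obtain ⟨rfl, q', k1, rfl, k3⟩ := hq
  refine ⟨rfl, fun s => inner ℝ (p s) (q' s) + inner ℝ (p' s) (q s), ?_, rfl, ?_⟩
  · filter_upwards [h1, k1] with s hs ks using hs.inner ℝ ks
  · refine ((h1.self_of_nhds.inner ℝ k3).add (h3.inner ℝ k1.self_of_nhds)).congr_deriv ?_
    ring

theorem HasTwoJet.norm_sq {F : Type*} [NormedAddCommGroup F] [InnerProductSpace ℝ F]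
    {p : ℝ → F} {a b c : F} (hp : HasTwoJet p a b c) :
    HasTwoJet (fun s => ‖p s‖ ^ 2) (‖a‖ ^ 2) (2 * Inner.inner ℝ a b)
      (2 * Inner.inner ℝ a c + 2 * ‖b‖ ^ 2) := by
  have h := hp.real_inner hp
  simp only [real_inner_self_eq_norm_sq] at h
  refine h.congr rfl ?_ ?_
  · rw [real_inner_comm a b]; ring
  · rw [real_inner_comm a c]; ring

theorem HasTwoJet.log {p : ℝ → ℝ} {a b c : ℝ} (hp : HasTwoJet p a b c) (ha : a ≠ 0) :
    HasTwoJet (fun s => Real.log (p s)) (Real.log a) (b / a) (c / a - b ^ 2 / a ^ 2) := by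
  obtain ⟨rfl, p', h1, rfl, h3⟩ := hp
  have hne : ∀ᶠ s in 𝓝 (0 : ℝ), p s ≠ 0 := h1.self_of_nhds.continuousAt.eventually_ne ha
  refine ⟨rfl, fun s => p' s / p s, ?_, rfl, ?_⟩
  · filter_upwards [h1, hne] with s hs hn using hs.log hn
  · refine (h3.div h1.self_of_nhds ha).congr_deriv ?_
    field_simp

theorem HasTwoJet.comp_line {V : Type*} [NormedAddCommGroup V] [NormedSpace ℝ V] {g : V → E}
    {u : V} (a : V) (hg : ∀ᶠ y in 𝓝 u, DifferentiableAt ℝ g y)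
    (hg' : DifferentiableAt ℝ (fun y => fderiv ℝ g y a) u) :
    HasTwoJet (fun s : ℝ => g (u + s • a)) (g u) (fderiv ℝ g u a)
      (fderiv ℝ (fun y => fderiv ℝ g y a) u a) := by
  have hl : ∀ s : ℝ, HasDerivAt (fun s : ℝ => u + s • a) a s := fun s => by
    simpa using ((hasDerivAt_id s).smul_const a).const_add u
  have h0 : u + (0 : ℝ) • a = u := by simp
  refine ⟨by simp, fun s => fderiv ℝ g (u + s • a) a, ?_, by simp, ?_⟩
  · have : Filter.Tendsto (fun s : ℝ => u + s • a) (𝓝 0) (𝓝 u) := by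
      simpa using (hl 0).continuousAt.tendsto
    filter_upwards [this.eventually hg] with s hs
    exact hs.hasFDerivAt.comp_hasDerivAt s (hl s)
  · have : HasFDerivAt (fun y => fderiv ℝ g y a) (fderiv ℝ (fun y => fderiv ℝ g y a) u)
        (u + (0 : ℝ) • a) := by rw [h0]; exact hg'.hasFDerivAt
    exact this.comp_hasDerivAt 0 (hl 0)

theorem HasTwoJet.velocity_eq_zero {p : ℝ → ℝ} {a b c : ℝ} (hp : HasTwoJet p a b c)
    (h : IsLocalMax p 0) : b = 0 := by
  obtain ⟨-, p', h1, rfl, -⟩ := hp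
  exact h.hasDerivAt_eq_zero h1.self_of_nhds

/-- If `c` were positive, the second derivative test would make `0` a local minimum too, so `p`
would be constant near `0` and `c = 0`. -/
theorem HasTwoJet.acceleration_nonpos {p : ℝ → ℝ} {a b c : ℝ} (hp : HasTwoJet p a b c)
    (h : IsLocalMax p 0) : c ≤ 0 := by
  have hb := hp.velocity_eq_zero h
  obtain ⟨-, p', h1, rfl, h3⟩ := hp
  by_contra! hc
  have hd : deriv p =ᶠ[𝓝 0] p' := h1.mono fun s hs => hs.deriv
  have hmin : IsLocalMin p 0 := by
    refine isLocalMin_of_deriv_deriv_pos ?_ ?_ h1.self_of_nhds.continuousAt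
    · rw [hd.deriv_eq, h3.deriv]; exact hc
    · rw [h1.self_of_nhds.deriv, hb]
  have hconst : p =ᶠ[𝓝 0] fun _ => p 0 := by
    filter_upwards [h, hmin] with s h1 h2 using le_antisymm h1 h2
  have h4 : deriv p =ᶠ[𝓝 0] fun _ => 0 := by
    have := hconst.deriv
    simpa using this
  have h5 : deriv p' 0 = 0 := by
    rw [(hd.symm.trans h4).deriv_eq]; simp
  rw [h3.deriv] at h5
  exact hc.ne' h5

end Jet

/-! ### Conformal maps from the plane to the sphere -/

/-- Parseval's identity in the orthogonal frame `f₁, f₂, z`. -/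
theorem inner_eq_of_frame {z f₁ f₂ : E3} {l : ℝ} (hl : 0 < l) (hz : inner ℝ z z = (1 : ℝ))
    (h11 : inner ℝ f₁ f₁ = l) (h22 : inner ℝ f₂ f₂ = l) (h12 : inner ℝ f₁ f₂ = (0 : ℝ))
    (hz1 : inner ℝ z f₁ = (0 : ℝ)) (hz2 : inner ℝ z f₂ = (0 : ℝ)) (v w : E3) :
    inner ℝ v w = inner ℝ f₁ v * inner ℝ f₁ w / l + inner ℝ f₂ v * inner ℝ f₂ w / l +
      inner ℝ z v * inner ℝ z w := by
  have hs : √l * √l = l := Real.mul_self_sqrt hl.le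
  have hs0 : √l ≠ 0 := (Real.sqrt_pos.2 hl).ne'
  let e : Fin 3 → E3 := ![(√l)⁻¹ • f₁, (√l)⁻¹ • f₂, z]
  have he : Orthonormal ℝ e := by
    rw [orthonormal_iff_ite]
    have hz1' := hz1
    have hz2' := hz2
    have h12' := h12
    rw [real_inner_comm] at hz1' hz2' h12'
    have hi : (√l)⁻¹ * ((√l)⁻¹ * l) = 1 := by
      field_simp; nlinarith
    intro i j
    fin_cases i <;> fin_cases j <;>
      simp [e, inner_smul_left, inner_smul_right, -inner_self_eq_norm_sq_to_K, h11, h22, h12, hz1,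
        hz2, hz1', hz2', h12', hz, hi]
  let b := OrthonormalBasis.mk he (by
    have := he.linearIndependent.span_eq_top_of_card_eq_finrank' (by simp)
    exact this.ge)
  have hb := b.sum_inner_mul_inner v w
  have hbe : ∀ i, b i = e i := fun i => by simp [b]
  rw [Fin.sum_univ_three] at hb
  simp only [hbe, e, Matrix.cons_val_zero, Matrix.cons_val_one,
    Matrix.cons_val, inner_smul_left, inner_smul_right] at hb
  rw [← hb, real_inner_comm v f₁, real_inner_comm v f₂, real_inner_comm v z]
  simp only [RCLike.conj_to_real]
  field_simp
  rw [sq, hs]; ring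

section Partial

variable {E : Type*} [NormedAddCommGroup E] [NormedSpace ℝ E] {U : Set ℂ}

/-- The derivative of `g` in the direction `w`. -/
noncomputable def dirDeriv (w : ℂ) (g : ℂ → E) (ζ : ℂ) : E := fderiv ℝ g ζ w

theorem contDiffOn_dirDeriv (hU : IsOpen U) {g : ℂ → E} (hg : ContDiffOn ℝ ∞ g U) (w : ℂ) :
    ContDiffOn ℝ ∞ (dirDeriv w g) U :=
  (hg.fderiv_of_isOpen hU (by simp)).clm_apply contDiffOn_const

theorem differentiableAt_of_contDiffOn (hU : IsOpen U) {g : ℂ → E} (hg : ContDiffOn ℝ ∞ g U)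
    {ζ : ℂ} (hζ : ζ ∈ U) : DifferentiableAt ℝ g ζ :=
  (hg.contDiffAt (hU.mem_nhds hζ)).differentiableAt (by simp)

theorem dirDeriv_comm (hU : IsOpen U) {g : ℂ → E} (hg : ContDiffOn ℝ ∞ g U) (v w : ℂ)
    {ζ : ℂ} (hζ : ζ ∈ U) : dirDeriv v (dirDeriv w g) ζ = dirDeriv w (dirDeriv v g) ζ := by
  have h := hg.contDiffAt (hU.mem_nhds hζ)
  have hd : DifferentiableAt ℝ (fderiv ℝ g) ζ :=
    differentiableAt_of_contDiffOn hU (hg.fderiv_of_isOpen hU (by simp)) hζ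
  have hs : IsSymmSndFDerivAt ℝ g ζ := h.isSymmSndFDerivAt (by simpa using (WithTop.coe_le_coe.2 le_top : ((2 : ℕ∞) : WithTop ℕ∞) ≤ ∞))
  have key : ∀ a b : ℂ, dirDeriv a (dirDeriv b g) ζ = fderiv ℝ (fderiv ℝ g) ζ a b := by
    intro a b
    unfold dirDeriv
    rw [fderiv_clm_apply hd (differentiableAt_const b)]
    simp
  rw [key, key]; exact hs v w

theorem dirDeriv_congr (hU : IsOpen U) {g h : ℂ → E} (hgh : EqOn g h U) (w : ℂ) :
    EqOn (dirDeriv w g) (dirDeriv w h) U := fun ζ hζ => by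
  unfold dirDeriv
  rw [(hgh.eventuallyEq_of_mem (hU.mem_nhds hζ)).fderiv_eq]

theorem dirDeriv_inner {F : Type*} [NormedAddCommGroup F] [InnerProductSpace ℝ F]
    (hU : IsOpen U) {g h : ℂ → F} (hg : ContDiffOn ℝ ∞ g U)
    (hh : ContDiffOn ℝ ∞ h U) (w : ℂ) {ζ : ℂ} (hζ : ζ ∈ U) :
    dirDeriv w (fun y => (inner ℝ (g y) (h y) : ℝ)) ζ =
      inner ℝ (g ζ) (dirDeriv w h ζ) + inner ℝ (dirDeriv w g ζ) (h ζ) :=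
  fderiv_inner_apply ℝ (differentiableAt_of_contDiffOn hU hg hζ)
    (differentiableAt_of_contDiffOn hU hh hζ) w

end Partial

/-- A conformal map to the unit sphere, parametrized by an open subset of the plane; `l` is its
conformal factor. -/
structure IsConformalParam (U : Set ℂ) (F : ℂ → E3) (l : ℂ → ℝ) : Prop where
  isOpen : IsOpen U
  contDiffOn : ContDiffOn ℝ ∞ F U
  sphere : ∀ ζ ∈ U, inner ℝ (F ζ) (F ζ) = (1 : ℝ)
  pos : ∀ ζ ∈ U, 0 < l ζ
  inner_one_one : ∀ ζ ∈ U, inner ℝ (dirDeriv 1 F ζ) (dirDeriv 1 F ζ) = l ζ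
  inner_I_I : ∀ ζ ∈ U, inner ℝ (dirDeriv Complex.I F ζ) (dirDeriv Complex.I F ζ) = l ζ
  inner_one_I : ∀ ζ ∈ U, inner ℝ (dirDeriv 1 F ζ) (dirDeriv Complex.I F ζ) = (0 : ℝ)

namespace IsConformalParam

variable {U : Set ℂ} {F : ℂ → E3} {l : ℂ → ℝ}

theorem contDiffOn_factor (hF : IsConformalParam U F l) : ContDiffOn ℝ ∞ l U := by
  have h1 := contDiffOn_dirDeriv hF.isOpen hF.contDiffOn 1
  exact (h1.inner ℝ h1).congr fun ζ hζ => (hF.inner_one_one ζ hζ).symm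

theorem inner_dirDeriv (hF : IsConformalParam U F l) (w : ℂ) {ζ : ℂ} (hζ : ζ ∈ U) :
    inner ℝ (F ζ) (dirDeriv w F ζ) = (0 : ℝ) := by
  have h := dirDeriv_congr (h := fun _ => (1 : ℝ)) hF.isOpen hF.sphere w hζ
  rw [dirDeriv_inner hF.isOpen hF.contDiffOn hF.contDiffOn w hζ, real_inner_comm (F ζ)] at h
  have h0 : dirDeriv w (fun _ : ℂ => (1 : ℝ)) ζ = 0 := by simp [dirDeriv]
  linarith

theorem inner_dirDeriv_dirDeriv (hF : IsConformalParam U F l) (v w : ℂ) {ζ : ℂ} (hζ : ζ ∈ U) :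
    inner ℝ (F ζ) (dirDeriv v (dirDeriv w F) ζ) =
      -(inner ℝ (dirDeriv v F ζ) (dirDeriv w F ζ) : ℝ) := by
  have h := dirDeriv_congr (h := fun _ => (0 : ℝ)) hF.isOpen
    (fun ζ hζ => hF.inner_dirDeriv w hζ) v hζ
  rw [dirDeriv_inner hF.isOpen hF.contDiffOn
    (contDiffOn_dirDeriv hF.isOpen hF.contDiffOn w) v hζ] at h
  have h0 : dirDeriv v (fun _ : ℂ => (0 : ℝ)) ζ = 0 := by simp [dirDeriv]
  linarith

/-- The first derivatives of the coefficients of the first fundamental form. -/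
theorem first_order (hF : IsConformalParam U F l) (w : ℂ) {ζ : ℂ} (hζ : ζ ∈ U) :
    2 * inner ℝ (dirDeriv 1 F ζ) (dirDeriv w (dirDeriv 1 F) ζ) = dirDeriv w l ζ ∧
    2 * inner ℝ (dirDeriv Complex.I F ζ) (dirDeriv w (dirDeriv Complex.I F) ζ) =
      dirDeriv w l ζ ∧
    inner ℝ (dirDeriv 1 F ζ) (dirDeriv w (dirDeriv Complex.I F) ζ) +
      inner ℝ (dirDeriv w (dirDeriv 1 F) ζ) (dirDeriv Complex.I F ζ) = (0 : ℝ) := by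
  have s1 := contDiffOn_dirDeriv hF.isOpen hF.contDiffOn 1
  have s2 := contDiffOn_dirDeriv hF.isOpen hF.contDiffOn Complex.I
  have h1 := dirDeriv_congr hF.isOpen hF.inner_one_one w hζ
  have h2 := dirDeriv_congr hF.isOpen hF.inner_I_I w hζ
  have h3 := dirDeriv_congr (h := fun _ => (0 : ℝ)) hF.isOpen hF.inner_one_I w hζ
  rw [dirDeriv_inner hF.isOpen s1 s1 w hζ, real_inner_comm (dirDeriv 1 F ζ)] at h1
  rw [dirDeriv_inner hF.isOpen s2 s2 w hζ, real_inner_comm (dirDeriv Complex.I F ζ)] at h2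
  rw [dirDeriv_inner hF.isOpen s1 s2 w hζ] at h3
  have h0 : dirDeriv w (fun _ : ℂ => (0 : ℝ)) ζ = 0 := by simp [dirDeriv]
  exact ⟨by linarith, by linarith, by linarith⟩

theorem parseval (hF : IsConformalParam U F l) {ζ : ℂ} (hζ : ζ ∈ U) (v w : E3) :
    inner ℝ v w = inner ℝ (dirDeriv 1 F ζ) v * inner ℝ (dirDeriv 1 F ζ) w / l ζ +
      inner ℝ (dirDeriv Complex.I F ζ) v * inner ℝ (dirDeriv Complex.I F ζ) w / l ζ +
      inner ℝ (F ζ) v * inner ℝ (F ζ) w :=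
  inner_eq_of_frame (hF.pos ζ hζ) (hF.sphere ζ hζ) (hF.inner_one_one ζ hζ) (hF.inner_I_I ζ hζ)
    (hF.inner_one_I ζ hζ) (hF.inner_dirDeriv 1 hζ) (hF.inner_dirDeriv Complex.I hζ) v w

/-- Conformal maps to the sphere are harmonic. -/
theorem laplacian_eq (hF : IsConformalParam U F l) {ζ : ℂ} (hζ : ζ ∈ U) :
    dirDeriv 1 (dirDeriv 1 F) ζ + dirDeriv Complex.I (dirDeriv Complex.I F) ζ =
      -(2 * l ζ) • F ζ := by
  obtain ⟨a1, a2, a3⟩ := hF.first_order 1 hζ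
  obtain ⟨b1, b2, b3⟩ := hF.first_order Complex.I hζ
  have hc := dirDeriv_comm hF.isOpen hF.contDiffOn Complex.I 1 hζ
  have n1 := hF.inner_dirDeriv_dirDeriv 1 1 hζ
  have n2 := hF.inner_dirDeriv_dirDeriv Complex.I Complex.I hζ
  have z1 := hF.inner_dirDeriv 1 hζ
  have z2 := hF.inner_dirDeriv Complex.I hζ
  rw [hF.inner_one_one ζ hζ] at n1
  rw [hF.inner_I_I ζ hζ] at n2
  rw [hc] at b1 b3
  refine ext_inner_left ℝ fun v => ?_
  have e0 := hF.sphere ζ hζ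
  rw [hF.parseval hζ v, hF.parseval hζ v (_ • _)]
  simp only [inner_add_right, inner_smul_right]
  rw [real_inner_comm (F ζ) (dirDeriv 1 F ζ), real_inner_comm (F ζ) (dirDeriv Complex.I F ζ),
    n1, n2, z1, z2, e0]
  -- The tangential components vanish by conformality: `⟨F₁, F₂₂⟩ = -⟨F₁₂, F₂⟩ = -∂₁l/2 = -⟨F₁,
  -- F₁₁⟩`, and symmetrically for `F₂`.
  have k1 : inner ℝ (dirDeriv 1 F ζ) (dirDeriv 1 (dirDeriv 1 F) ζ) +
      inner ℝ (dirDeriv 1 F ζ) (dirDeriv Complex.I (dirDeriv Complex.I F) ζ) = (0 : ℝ) := by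
    rw [real_inner_comm (dirDeriv Complex.I F ζ)] at b3; linarith
  have k2 : inner ℝ (dirDeriv Complex.I F ζ) (dirDeriv 1 (dirDeriv 1 F) ζ) +
      inner ℝ (dirDeriv Complex.I F ζ) (dirDeriv Complex.I (dirDeriv Complex.I F) ζ) =
        (0 : ℝ) := by
    rw [real_inner_comm (dirDeriv Complex.I F ζ)] at a3; linarith
  rw [k1, k2]
  ring

/-- The metric induced on the sphere has curvature one. -/
theorem liouville (hF : IsConformalParam U F l) {ζ : ℂ} (hζ : ζ ∈ U) :
    l ζ * (dirDeriv 1 (dirDeriv 1 l) ζ + dirDeriv Complex.I (dirDeriv Complex.I l) ζ) -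
      (dirDeriv 1 l ζ ^ 2 + dirDeriv Complex.I l ζ ^ 2) = -(2 * l ζ ^ 3) := by
  set f₁ := dirDeriv 1 F with hf₁
  set f₂ := dirDeriv Complex.I F with hf₂
  have hU := hF.isOpen
  have s1 : ContDiffOn ℝ ∞ f₁ U := contDiffOn_dirDeriv hU hF.contDiffOn 1
  have s2 : ContDiffOn ℝ ∞ f₂ U := contDiffOn_dirDeriv hU hF.contDiffOn Complex.I
  have hl := hF.pos ζ hζ
  obtain ⟨a1, a2, a3⟩ := hF.first_order 1 hζ
  obtain ⟨b1, -, -⟩ := hF.first_order Complex.I hζ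
  have hc : dirDeriv Complex.I f₁ ζ = dirDeriv 1 f₂ ζ :=
    dirDeriv_comm hU hF.contDiffOn Complex.I 1 hζ
  have hess : ∀ w, dirDeriv w (dirDeriv w l) ζ = 2 * (inner ℝ (f₁ ζ) (dirDeriv w (dirDeriv w f₁) ζ)
      + inner ℝ (dirDeriv w f₁ ζ) (dirDeriv w f₁ ζ)) := by
    intro w
    have h : EqOn (dirDeriv w l) (fun y => 2 * inner ℝ (f₁ y) (dirDeriv w f₁ y)) U :=
      fun y hy => (hF.first_order w hy).1.symm
    have sw := contDiffOn_dirDeriv hU s1 w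
    rw [dirDeriv_congr hU h w hζ, ← dirDeriv_inner hU s1 sw w hζ]
    have hd := differentiableAt_of_contDiffOn hU (s1.inner ℝ sw) hζ
    unfold dirDeriv at hd ⊢
    rw [fderiv_const_mul hd]
    simp
  have third : dirDeriv Complex.I (dirDeriv Complex.I f₁) ζ =
      dirDeriv 1 (dirDeriv Complex.I f₂) ζ := by
    have h : EqOn (dirDeriv Complex.I f₁) (dirDeriv 1 f₂) U :=
      fun y hy => dirDeriv_comm hU hF.contDiffOn Complex.I 1 hy
    rw [dirDeriv_congr hU h _ hζ]
    exact dirDeriv_comm hU s2 Complex.I 1 hζ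
  have s11 := contDiffOn_dirDeriv hU s1 1
  have s22 := contDiffOn_dirDeriv hU s2 Complex.I
  -- Third derivatives of `F` enter `Δl` only through `⟨F₁, ∂₁(ΔF)⟩`. Since `ΔF` is normal to the
  -- sphere, differentiating `⟨F₁, ΔF⟩ = 0` trades them for second derivatives.
  have tang : EqOn (fun y => (inner ℝ (f₁ y) (dirDeriv 1 f₁ y + dirDeriv Complex.I f₂ y) : ℝ))
      (fun _ => 0) U := by
    intro y hy
    have h0 := hF.inner_dirDeriv 1 hy
    rw [real_inner_comm] at h0
    simp only [hf₁, hf₂, hF.laplacian_eq hy, inner_smul_right, h0, mul_zero]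
  have h := dirDeriv_congr hU tang 1 hζ
  rw [dirDeriv_inner hU s1 (s11.add s22) 1 hζ, hF.laplacian_eq hζ] at h
  have hadd : dirDeriv 1 (fun y => dirDeriv 1 f₁ y + dirDeriv Complex.I f₂ y) ζ =
      dirDeriv 1 (dirDeriv 1 f₁) ζ + dirDeriv 1 (dirDeriv Complex.I f₂) ζ := by
    have d1 := differentiableAt_of_contDiffOn hU s11 hζ
    have d2 := differentiableAt_of_contDiffOn hU s22 hζ
    rw [dirDeriv, fderiv_fun_add d1 d2]; rfl
  have h0 : dirDeriv 1 (fun _ : ℂ => (0 : ℝ)) ζ = 0 := by simp [dirDeriv]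
  have n1 := hF.inner_dirDeriv_dirDeriv 1 1 hζ
  have n2 := hF.inner_dirDeriv_dirDeriv 1 Complex.I hζ
  rw [hF.inner_one_one ζ hζ] at n1
  rw [hF.inner_one_I ζ hζ] at n2
  rw [hadd, h0, inner_add_right, inner_smul_right, real_inner_comm (F ζ), n1] at h
  rw [hess, hess, third, hc, hF.parseval hζ (dirDeriv 1 f₁ ζ), hF.parseval hζ (dirDeriv 1 f₂ ζ),
    n1, n2]
  rw [hc] at b1
  rw [real_inner_comm (f₂ ζ)] at a3
  simp only [← hf₁, ← hf₂] at a1 a2 a3 b1 h ⊢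
  rw [← a1] at a2 ⊢
  rw [← b1]
  have e1 : inner ℝ (f₂ ζ) (dirDeriv 1 f₁ ζ) = -(inner ℝ (f₁ ζ) (dirDeriv 1 f₂ ζ) : ℝ) := by
    linarith
  have e2 : inner ℝ (f₂ ζ) (dirDeriv 1 f₂ ζ) = (inner ℝ (f₁ ζ) (dirDeriv 1 f₁ ζ) : ℝ) := by
    linarith
  rw [e1, e2]
  field_simp
  linear_combination l ζ * h

end IsConformalParam
/-! ### Traces of the second fundamental form -/

open Matrix in
-- The columns of `P` form a `G`-orthogonal frame of squared length `c`, so `G⁻¹ = c⁻¹ P Pᵀ` and the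
-- trace can be read off in that frame.
theorem trace_inv_mul_of_conj {G S P : Matrix (Fin 2) (Fin 2) ℝ} {c : ℝ} (hc : c ≠ 0)
    (h : Pᵀ * G * P = c • (1 : Matrix (Fin 2) (Fin 2) ℝ)) :
    c * (G⁻¹ * S).trace = (Pᵀ * S * P).trace := by
  have h1 : (c⁻¹ • (Pᵀ * G)) * P = 1 := by
    rw [Matrix.smul_mul, h, smul_smul, inv_mul_cancel₀ hc, one_smul]
  have h2 : P * (c⁻¹ • (Pᵀ * G)) = 1 := mul_eq_one_comm.1 h1
  have h3 : G⁻¹ = c⁻¹ • (P * Pᵀ) := by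
    refine Matrix.inv_eq_left_inv ?_
    rw [Matrix.smul_mul, Matrix.mul_assoc, ← Matrix.mul_smul, h2]
  rw [h3, Matrix.smul_mul, Matrix.trace_smul, smul_eq_mul, mul_inv_cancel_left₀ hc,
    Matrix.mul_assoc, Matrix.trace_mul_comm]

theorem clm_apply_eq_coords {E : Type*} [NormedAddCommGroup E] [NormedSpace ℝ E] (L : E2 →L[ℝ] E)
    (a : E2) :
    L a = a 0 • L (EuclideanSpace.single 0 1) + a 1 • L (EuclideanSpace.single 1 1) := by
  have : a = a 0 • EuclideanSpace.single 0 1 + a 1 • EuclideanSpace.single 1 (1 : ℝ) := by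
    ext i; fin_cases i <;> simp
  conv_lhs => rw [this]
  simp

/-- The second fundamental form of `X` at `u`, on the vector `a`. -/
noncomputable def secondFormQuad (X : E2 → E3) (u : E2) (N : E3) (a : E2) : ℝ :=
  hypMetric (X u) (fderiv ℝ (fun y => fderiv ℝ X y a) u a +
    christoffel (X u) (fderiv ℝ X u a) (fderiv ℝ X u a)) N

theorem secondFormQuad_eq {X : E2 → E3} {u : E2} (hX : DifferentiableAt ℝ (fderiv ℝ X) u) (N : E3)
    (a : E2) :
    secondFormQuad X u N a = a 0 * a 0 * secondForm X u N 0 0 + a 0 * a 1 * secondForm X u N 0 1 +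
      a 1 * a 0 * secondForm X u N 1 0 + a 1 * a 1 * secondForm X u N 1 1 := by
  have hd : ∀ i, DifferentiableAt ℝ (coordField X i) u := fun i =>
    hX.clm_apply (differentiableAt_const _)
  have h1 : (fun y => fderiv ℝ X y a) =
      fun y => a 0 • coordField X 0 y + a 1 • coordField X 1 y := by
    ext1 y; exact clm_apply_eq_coords _ a
  have h2 : fderiv ℝ (fun y => a 0 • coordField X 0 y + a 1 • coordField X 1 y) u =
      a 0 • fderiv ℝ (coordField X 0) u + a 1 • fderiv ℝ (coordField X 1) u := by
    rw [fderiv_fun_add ((hd 0).fun_const_smul _) ((hd 1).fun_const_smul _),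
      fderiv_fun_const_smul (hd 0), fderiv_fun_const_smul (hd 1)]
  have h3 : fderiv ℝ X u a = a 0 • coordField X 0 u + a 1 • coordField X 1 u :=
    clm_apply_eq_coords _ a
  unfold secondFormQuad
  rw [h1, h2, h3, clm_apply_eq_coords _ a]
  simp only [secondForm, Matrix.of_apply, hypMetric, christoffel, inner_add_left, inner_add_right,
    inner_smul_left, inner_smul_right, inner_sub_left, _root_.add_apply,
    _root_.smul_apply, RCLike.conj_to_real]
  ring

/-- Minimality in the form used at the contact point, where the available tangent vectors are
orthogonal of equal length but unrelated to the coordinate fields. -/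
theorem secondFormQuad_add_eq_zero {X : E2 → E3} {u : E2} {N : E3}
    (hX : DifferentiableAt ℝ (fderiv ℝ X) u)
    (hH : meanCurvature X u N = 0) {a b : E2} {c : ℝ} (hc : c ≠ 0)
    (haa : hypMetric (X u) (fderiv ℝ X u a) (fderiv ℝ X u a) = c)
    (hbb : hypMetric (X u) (fderiv ℝ X u b) (fderiv ℝ X u b) = c)
    (hab : hypMetric (X u) (fderiv ℝ X u a) (fderiv ℝ X u b) = 0) :
    secondFormQuad X u N a + secondFormQuad X u N b = 0 := by
  have hba : hypMetric (X u) (fderiv ℝ X u b) (fderiv ℝ X u a) = 0 := by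
    rw [← hab, hypMetric, hypMetric, real_inner_comm]
  have h3 : ∀ a : E2, fderiv ℝ X u a = a 0 • coordField X 0 u + a 1 • coordField X 1 u :=
    clm_apply_eq_coords _
  have key : ∀ a b : E2, hypMetric (X u) (fderiv ℝ X u a) (fderiv ℝ X u b) =
      a 0 * b 0 * firstForm X u 0 0 + a 0 * b 1 * firstForm X u 0 1 +
      a 1 * b 0 * firstForm X u 1 0 + a 1 * b 1 * firstForm X u 1 1 := by
    intro a b
    rw [h3 a, h3 b]
    simp only [firstForm, Matrix.of_apply, hypMetric, inner_add_left, inner_add_right,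
      inner_smul_left, inner_smul_right, RCLike.conj_to_real]
    ring
  rw [key] at haa hbb hab hba
  have h := trace_inv_mul_of_conj (G := firstForm X u) (S := secondForm X u N)
    (P := !![a 0, b 0; a 1, b 1]) hc (by
      ext i j
      fin_cases i <;> fin_cases j <;>
        simp [Matrix.mul_apply, Fin.sum_univ_two] <;> linarith)
  have h0 : ((firstForm X u)⁻¹ * secondForm X u N).trace = 0 := by
    have : (shapeOperator X u N).trace / 2 = 0 := hH
    simpa [shapeOperator] using this
  rw [h0, mul_zero] at h
  rw [secondFormQuad_eq hX, secondFormQuad_eq hX]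
  simp [Matrix.mul_apply, Matrix.trace, Fin.sum_univ_two] at h
  linarith

/-! ### The inequality at a point of contact -/

/-- The range of `L` is a plane inside the plane `nᗮ`, hence all of it. This turns a prescribed
tangent velocity into a direction in the parameter domain. -/
theorem exists_apply_eq_of_orthogonal {L : E2 →L[ℝ] E3} (hL : Function.Injective L) {n w : E3}
    (hn : n ≠ 0) (h : ∀ a, inner ℝ n (L a) = (0 : ℝ)) (hw : inner ℝ n w = (0 : ℝ)) :
    ∃ a, L a = w := by
  have : Fact (Module.finrank ℝ E3 = 2 + 1) := ⟨by simp⟩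
  have h1 : LinearMap.range (L : E2 →ₗ[ℝ] E3) = (ℝ ∙ n)ᗮ := by
    refine Submodule.eq_of_le_of_finrank_eq ?_ ?_
    · rintro _ ⟨a, rfl⟩
      exact Submodule.mem_orthogonal_singleton_iff_inner_right.2 (h a)
    · rw [Submodule.finrank_orthogonal_span_singleton (n := 2) hn,
        LinearMap.finrank_range_of_inj hL]
      simp
  have : w ∈ LinearMap.range (L : E2 →ₗ[ℝ] E3) := by
    rw [h1]; exact Submodule.mem_orthogonal_singleton_iff_inner_right.2 hw
  exact this

/-- The reflection in the plane orthogonal to `x - z`. -/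
noncomputable def reflect (x z v : E3) : E3 :=
  v - (2 * inner ℝ (x - z) v / ‖x - z‖ ^ 2) • (x - z)

theorem inner_reflect (x z v w : E3) :
    inner ℝ (reflect x z v) (reflect x z w) = (inner ℝ v w : ℝ) := by
  unfold reflect
  rw [inner_sub_left, inner_sub_right, inner_sub_right, inner_smul_left, inner_smul_left,
    inner_smul_right, inner_smul_right, real_inner_self_eq_norm_sq, real_inner_comm (x - z) v]
  simp only [RCLike.conj_to_real]
  field_simp
  ring

/-- Inner products in terms of `A = 1 - |x|²` and `D = |x - z|²`. -/
theorem inner_eq_of_dist {x z : E3} (hz : ‖z‖ = 1) :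
    inner ℝ x x = 1 - (1 - ‖x‖ ^ 2) ∧
    inner ℝ x z = (2 - (1 - ‖x‖ ^ 2) - ‖x - z‖ ^ 2) / 2 ∧ inner ℝ z x =
      (2 - (1 - ‖x‖ ^ 2) - ‖x - z‖ ^ 2) / 2 ∧ inner ℝ z z = (1 : ℝ) := by
  have h := norm_sub_sq_real x z
  rw [hz] at h
  refine ⟨?_, ?_, ?_, ?_⟩
  · rw [real_inner_self_eq_norm_sq]; ring
  · linarith
  · rw [real_inner_comm]; linarith
  · rw [real_inner_self_eq_norm_sq, hz]; norm_num

theorem inner_outwardNormal (x : E3) (z : S2) (v : E3) :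
    inner ℝ (outwardNormal z x) v = (1 - ‖x‖ ^ 2) / 2 * inner ℝ x v +
      (1 - ‖x‖ ^ 2) ^ 2 / (2 * ‖x - (z : E3)‖ ^ 2) * inner ℝ (x - (z : E3)) v := by
  simp [outwardNormal, inner_add_left, inner_smul_left]

/-- The reflection carries the tangent plane of the sphere at `z` into that of the horosphere at
`x`; being isometric, it sends conformal frames to conformal frames. -/
theorem inner_outwardNormal_reflect {x : E3} {z : S2} (hD : ‖x - (z : E3)‖ ^ 2 ≠ 0) {f : E3}
    (hf : inner ℝ (z : E3) f = (0 : ℝ)) :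
    inner ℝ (outwardNormal z x) (reflect x z f) = (0 : ℝ) := by
  obtain ⟨h1, h2, h3, h4⟩ := inner_eq_of_dist (x := x) (norm_eq_of_mem_sphere z)
  rw [inner_outwardNormal]
  simp only [reflect, inner_sub_left, inner_sub_right, inner_smul_right, h1, h2, h3, h4, hf]
  generalize ‖x - (z : E3)‖ ^ 2 = D at *
  generalize 1 - ‖x‖ ^ 2 = A at *
  field_simp
  ring

theorem inner_outwardNormal_self {x : E3} {z : S2} (hD : ‖x - (z : E3)‖ ^ 2 ≠ 0) :
    inner ℝ (outwardNormal z x) (outwardNormal z x) = ((1 - ‖x‖ ^ 2) ^ 2 / 4 : ℝ) := by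
  obtain ⟨h1, h2, h3, h4⟩ := inner_eq_of_dist (x := x) (norm_eq_of_mem_sphere z)
  rw [inner_outwardNormal]
  simp only [outwardNormal, inner_add_right, inner_sub_left, inner_sub_right, inner_smul_right, h1,
    h2, h3, h4]
  generalize ‖x - (z : E3)‖ ^ 2 = D at *
  generalize 1 - ‖x‖ ^ 2 = A at *
  field_simp
  ring

/-- The second variation of `log ((1 - |x|²) / |x - z|²)` when `x` and `z` move with velocities
related by the reflection. -/
theorem second_variation_eq {x : E3} {z : S2} {f ff xx v : E3} (hA : 1 - ‖x‖ ^ 2 ≠ 0)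
    (hD : ‖x - (z : E3)‖ ^ 2 ≠ 0) (hf : inner ℝ (z : E3) f = (0 : ℝ))
    (hv : v = ((1 - ‖x‖ ^ 2) ^ 2 / (2 * ‖x - (z : E3)‖ ^ 2)) • reflect x z f) :
    (-(2 * inner ℝ x xx + 2 * ‖v‖ ^ 2)) / (1 - ‖x‖ ^ 2) -
        (-(2 * inner ℝ x v)) ^ 2 / (1 - ‖x‖ ^ 2) ^ 2 -
      ((2 * inner ℝ (x - (z : E3)) (xx - ff) + 2 * ‖v - f‖ ^ 2) / ‖x - (z : E3)‖ ^ 2 -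
        (2 * inner ℝ (x - (z : E3)) (v - f)) ^ 2 / (‖x - (z : E3)‖ ^ 2) ^ 2) =
    -hypMetric x (xx + christoffel x v v) (outwardNormal z x) +
      (1 - ‖x‖ ^ 2) ^ 2 * inner ℝ f f / (‖x - (z : E3)‖ ^ 2) ^ 2 -
      2 * inner ℝ f f / ‖x - (z : E3)‖ ^ 2 +
      2 * inner ℝ (x - (z : E3)) ff / ‖x - (z : E3)‖ ^ 2 +
      4 * inner ℝ x f ^ 2 / (‖x - (z : E3)‖ ^ 2) ^ 2 := by
  obtain ⟨h1, h2, h3, h4⟩ := inner_eq_of_dist (x := x) (norm_eq_of_mem_sphere z)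
  have hvv : ‖v‖ ^ 2 = ((1 - ‖x‖ ^ 2) ^ 2 / (2 * ‖x - (z : E3)‖ ^ 2)) ^ 2 * inner ℝ f f := by
    rw [hv, norm_smul, mul_pow, Real.norm_eq_abs, sq_abs,
      ← real_inner_self_eq_norm_sq (reflect _ _ _), inner_reflect]
  have hxv : inner ℝ x v = (1 - ‖x‖ ^ 2) ^ 2 / (2 * ‖x - (z : E3)‖ ^ 2) *
      ((1 - ‖x‖ ^ 2) / ‖x - (z : E3)‖ ^ 2 * inner ℝ x f) := by
    rw [hv]
    simp only [reflect, inner_sub_left, inner_sub_right, inner_smul_right, h1, h2, hf]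
    generalize ‖x - (z : E3)‖ ^ 2 = D at *
    generalize 1 - ‖x‖ ^ 2 = A at *
    field_simp
    ring
  have hzv : inner ℝ (z : E3) v = (1 - ‖x‖ ^ 2) ^ 2 / (2 * ‖x - (z : E3)‖ ^ 2) *
      ((1 - ‖x‖ ^ 2 + ‖x - (z : E3)‖ ^ 2) / ‖x - (z : E3)‖ ^ 2 * inner ℝ x f) := by
    rw [hv]
    simp only [reflect, inner_sub_left, inner_sub_right, inner_smul_right, h3, h4, hf]
    generalize ‖x - (z : E3)‖ ^ 2 = D at *
    generalize 1 - ‖x‖ ^ 2 = A at *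
    field_simp
    ring
  have hvf : inner ℝ v f = (1 - ‖x‖ ^ 2) ^ 2 / (2 * ‖x - (z : E3)‖ ^ 2) *
      (inner ℝ f f - 2 * inner ℝ x f ^ 2 / ‖x - (z : E3)‖ ^ 2) := by
    rw [hv]
    simp only [reflect, inner_sub_left, inner_smul_left, hf, RCLike.conj_to_real]
    ring
  have hvf2 : ‖v - f‖ ^ 2 = ‖v‖ ^ 2 - 2 * inner ℝ v f + inner ℝ f f := by
    rw [norm_sub_sq_real, real_inner_self_eq_norm_sq]
  have hvv' : inner ℝ v v = ‖v‖ ^ 2 := real_inner_self_eq_norm_sq v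
  rw [hvf2, hypMetric, real_inner_comm (outwardNormal z x), inner_outwardNormal]
  simp only [christoffel, inner_sub_left, inner_sub_right, inner_add_right, inner_smul_right, h1,
    h3, hvv', hxv, hzv, hvf, hvv, hf]
  generalize ‖x - (z : E3)‖ ^ 2 = D at *
  generalize 1 - ‖x‖ ^ 2 = A at *
  field_simp
  ring

theorem hasTwoJet_log_ratio {p q : ℝ → E3} {m : ℝ → ℝ} {y : ℝ → ℂ} {x v xx z f ff : E3}
    {l l' l'' r : ℝ} {ζ w : ℂ} (hp : HasTwoJet p x v xx) (hq : HasTwoJet q z f ff)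
    (hm : HasTwoJet m l l' l'') (hy : HasTwoJet y ζ w 0) (hA : 1 - ‖x‖ ^ 2 ≠ 0)
    (hD : ‖x - z‖ ^ 2 ≠ 0) (hl : l ≠ 0) (hr : r ^ 2 - ‖ζ‖ ^ 2 ≠ 0) :
    HasTwoJet (fun s => 2 * Real.log (1 - ‖p s‖ ^ 2) - 2 * Real.log (‖p s - q s‖ ^ 2) +
        Real.log (m s) + 2 * Real.log (r ^ 2 - ‖y s‖ ^ 2))
      (2 * Real.log (1 - ‖x‖ ^ 2) - 2 * Real.log (‖x - z‖ ^ 2) +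
        Real.log l + 2 * Real.log (r ^ 2 - ‖ζ‖ ^ 2))
      (2 * (-(2 * inner ℝ x v) / (1 - ‖x‖ ^ 2)) -
        2 * (2 * inner ℝ (x - z) (v - f) / ‖x - z‖ ^ 2) + l' / l +
        2 * (-(2 * inner ℝ ζ w) / (r ^ 2 - ‖ζ‖ ^ 2)))
      (2 * ((-(2 * inner ℝ x xx + 2 * ‖v‖ ^ 2)) / (1 - ‖x‖ ^ 2) -
          (-(2 * inner ℝ x v)) ^ 2 / (1 - ‖x‖ ^ 2) ^ 2 -
        ((2 * inner ℝ (x - z) (xx - ff) + 2 * ‖v - f‖ ^ 2) / ‖x - z‖ ^ 2 -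
          (2 * inner ℝ (x - z) (v - f)) ^ 2 / (‖x - z‖ ^ 2) ^ 2)) +
        (l'' / l - l' ^ 2 / l ^ 2) +
        2 * (-(2 * ‖w‖ ^ 2) / (r ^ 2 - ‖ζ‖ ^ 2) -
          (2 * inner ℝ ζ w) ^ 2 / (r ^ 2 - ‖ζ‖ ^ 2) ^ 2)) := by
  have h1 := (((hasTwoJet_const (1 : ℝ)).sub hp.norm_sq).log hA).const_smul (2 : ℝ)
  have h2 := ((hp.sub hq).norm_sq.log hD).const_smul (2 : ℝ)
  have h4 := (((hasTwoJet_const (r ^ 2)).sub hy.norm_sq).log hr).const_smul (2 : ℝ)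
  refine (((h1.sub h2).add (hm.log hl)).add h4).congr ?_ ?_ ?_
  · simp only [smul_eq_mul]
  · simp only [smul_eq_mul, zero_sub]
  · simp only [smul_eq_mul, zero_sub, inner_zero_right]
    ring

/-- The logarithm of `ν_x(f ζ) · l(ζ) · (r² - |ζ|²)²`. -/
noncomputable def logRatio (f : ℂ → S2) (l : ℂ → ℝ) (r : ℝ) (x : E3) (ζ : ℂ) : ℝ :=
  2 * Real.log (1 - ‖x‖ ^ 2) - 2 * Real.log (‖x - (f ζ : E3)‖ ^ 2) +
        Real.log (l ζ) + 2 * Real.log (r ^ 2 - ‖ζ‖ ^ 2)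

/-- The algebra of the Ahlfors argument. Here `A = 1 - |x|²`, `D = |x - z|²`, `E = r² - |ζ|²`, `L =
l(ζ)`, `R = r²`; `kᵢ` are values of the second fundamental form, `sᵢ = ⟨x - z, Fᵢᵢ⟩`, `α` and `β`
are `⟨x, Fᵢ⟩`, and `p`, `q` are the coordinates of `ζ`. The sum of `h₁` and `h₂` is exactly
`2(L(A/D)² - 4R/E²) ≤ 0`. -/
theorem ahlfors_of_second_variation {A D E L n R s₁ s₂ α β p q l₁ l₂ l₁₁ l₂₂ k₁ k₂ : ℝ}
    (hD : 0 < D) (hE : 0 < E) (hL : 0 < L) (hR : R = E + n)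
    (hk : k₁ + k₂ = 0) (hs : s₁ + s₂ = -(2 * L) * ((2 - A - D) / 2 - 1))
    (hLi : L * (l₁₁ + l₂₂) - (l₁ ^ 2 + l₂ ^ 2) = -(2 * L ^ 3))
    (hp : 1 - A = α * α / L + β * β / L + (2 - A - D) / 2 * ((2 - A - D) / 2))
    (hn : p ^ 2 + q ^ 2 = n)
    (h₁ : 2 * (-k₁ + A ^ 2 * L / D ^ 2 - 2 * L / D + 2 * s₁ / D + 4 * α ^ 2 / D ^ 2) +
      (l₁₁ / L - l₁ ^ 2 / L ^ 2) + 2 * (-(2 * 1 ^ 2) / E - (2 * p) ^ 2 / E ^ 2) ≤ 0)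
    (h₂ : 2 * (-k₂ + A ^ 2 * L / D ^ 2 - 2 * L / D + 2 * s₂ / D + 4 * β ^ 2 / D ^ 2) +
      (l₂₂ / L - l₂ ^ 2 / L ^ 2) + 2 * (-(2 * 1 ^ 2) / E - (2 * q) ^ 2 / E ^ 2) ≤ 0) :
    L * (A / D) ^ 2 * E ^ 2 ≤ 4 * R := by
  have hα : α ^ 2 + β ^ 2 = L * (1 - A - (2 - A - D) / 2 * ((2 - A - D) / 2)) := by
    rw [hp]; field_simp; ring
  have hl : (l₁₁ / L - l₁ ^ 2 / L ^ 2) + (l₂₂ / L - l₂ ^ 2 / L ^ 2) = -(2 * L) := by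
    field_simp
    linear_combination hLi
  have e : 2 * (L * (A / D) ^ 2 - 4 * R / E ^ 2) = -2 * (k₁ + k₂) + 4 * A ^ 2 * L / D ^ 2 -
      8 * L / D + 4 / D * (s₁ + s₂) + 8 / D ^ 2 * (α ^ 2 + β ^ 2) +
      ((l₁₁ / L - l₁ ^ 2 / L ^ 2) + (l₂₂ / L - l₂ ^ 2 / L ^ 2)) - 8 / E -
      8 / E ^ 2 * (p ^ 2 + q ^ 2) := by
    rw [hk, hs, hα, hl, hn, hR]
    field_simp
    ring
  have h : L * (A / D) ^ 2 ≤ 4 * R / E ^ 2 := by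
    have h3 := add_nonpos h₁ h₂
    have : 2 * (L * (A / D) ^ 2 - 4 * R / E ^ 2) ≤ 0 := by
      rw [e]; refine le_of_eq_of_le ?_ h3; ring
    linarith
  rwa [le_div_iff₀ (by positivity)] at h

/-- The visual metrics from the points of a minimal surface satisfy Ahlfors' inequality at a point
where they are maximal relative to the Poincaré metric of a disk. -/
theorem contact_inequality {M : Set E3} (hM : IsMinimalSurface M) {f : ℂ → S2} {l : ℂ → ℝ}
    (hf : IsConformalParam (ball 0 1) (fun ζ => (f ζ : E3)) l) {r : ℝ}
    (hr1 : r ≤ 1) {x : E3} (hx : x ∈ M) {ζ : ℂ} (hζ : ζ ∈ ball (0 : ℂ) r)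
    (hmax : ∀ x' ∈ M, ∀ ζ' ∈ ball (0 : ℂ) r, logRatio f l r x' ζ' ≤ logRatio f l r x ζ) :
    l ζ * ((1 - ‖x‖ ^ 2) / ‖x - (f ζ : E3)‖ ^ 2) ^ 2 * (r ^ 2 - ‖ζ‖ ^ 2) ^ 2 ≤ 4 * r ^ 2 := by
  obtain ⟨U, X, hX, u, hu, rfl⟩ := hM.exists_param x hx
  obtain ⟨W, -, hW⟩ := hX.image_eq
  have hζ1 : ζ ∈ ball (0 : ℂ) 1 := ball_subset_ball hr1 hζ
  have hxn : ‖X u‖ < 1 := by simpa [H3] using hM.subset hx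
  have hζn : ‖ζ‖ < r := by simpa using hζ
  have hA : 0 < 1 - ‖X u‖ ^ 2 := by nlinarith [norm_nonneg (X u)]
  have hE : 0 < r ^ 2 - ‖ζ‖ ^ 2 := by nlinarith [norm_nonneg ζ]
  have hD : 0 < ‖X u - (f ζ : E3)‖ ^ 2 := by
    have : X u ≠ (f ζ : E3) := fun h => by
      rw [h, norm_eq_of_mem_sphere] at hxn; exact lt_irrefl _ hxn
    have := norm_pos_iff.2 (sub_ne_zero.2 this)
    positivity
  have hl := hf.pos ζ hζ1
  have hXu := hX.contDiffOn.contDiffAt (hX.isOpen_domain.mem_nhds hu)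
  have hXd : ∀ᶠ y in 𝓝 u, DifferentiableAt ℝ X y := by
    filter_upwards [hX.isOpen_domain.mem_nhds hu] with y hy
    exact (hX.contDiffOn.contDiffAt (hX.isOpen_domain.mem_nhds hy)).differentiableAt (by norm_num)
  have hXd2 : DifferentiableAt ℝ (fderiv ℝ X) u :=
    (hXu.fderiv_right (m := 1) (by norm_num)).differentiableAt (by norm_num)
  have jX : ∀ a : E2, HasTwoJet (fun s : ℝ => X (u + s • a)) (X u) (fderiv ℝ X u a)
      (fderiv ℝ (fun y => fderiv ℝ X y a) u a) := fun a =>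
    HasTwoJet.comp_line a hXd (hXd2.clm_apply (differentiableAt_const a))
  have jg : ∀ {E : Type} [NormedAddCommGroup E] [NormedSpace ℝ E] {g : ℂ → E}
      (_ : ContDiffOn ℝ ∞ g (ball 0 1)) (w : ℂ),
      HasTwoJet (fun s : ℝ => g (ζ + s • w)) (g ζ) (dirDeriv w g ζ)
        (dirDeriv w (dirDeriv w g) ζ) := by
    intro E _ _ g hg w
    refine HasTwoJet.comp_line w ?_
      (differentiableAt_of_contDiffOn isOpen_ball (contDiffOn_dirDeriv isOpen_ball hg w) hζ1)
    filter_upwards [isOpen_ball.mem_nhds hζ1] with y hy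
    exact differentiableAt_of_contDiffOn isOpen_ball hg hy
  have jid : ∀ w : ℂ, HasTwoJet (fun s : ℝ => ζ + s • w) ζ w 0 := fun w => by
    have h : dirDeriv w (fun y : ℂ => y) = fun _ => w := by ext y; simp [dirDeriv]
    exact (jg (g := fun y => y) contDiffOn_id w).congr rfl (by rw [h]) (by simp [h, dirDeriv])
  have jet := fun (a : E2) (w : ℂ) => hasTwoJet_log_ratio (r := r) (jX a) (jg hf.contDiffOn w)
    (jg hf.contDiffOn_factor w) (jid w) hA.ne' hD.ne' hl.ne' hE.ne'
  have lmax : ∀ (a : E2) (w : ℂ), IsLocalMax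
      (fun s : ℝ => logRatio f l r (X (u + s • a)) (ζ + s • w)) 0 := by
    intro a w
    have c1 : Filter.Tendsto (fun s : ℝ => u + s • a) (𝓝 0) (𝓝 u) := by
      have : Continuous fun s : ℝ => u + s • a := by fun_prop
      simpa using this.tendsto 0
    have c2 : Filter.Tendsto (fun s : ℝ => ζ + s • w) (𝓝 0) (𝓝 ζ) := by
      have : Continuous fun s : ℝ => ζ + s • w := by fun_prop
      simpa using this.tendsto 0
    filter_upwards [c1 (hX.isOpen_domain.mem_nhds hu), c2 (isOpen_ball.mem_nhds hζ)] with s h1 h2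
    have h3 : X (u + s • a) ∈ M := (hW ▸ mem_image_of_mem X h1 : X (u + s • a) ∈ M ∩ W).1
    simpa using hmax _ h3 _ h2
  -- Only `x` varies: `ν_x(f ζ)` is stationary along `M`, so `M` is tangent at `x` to the
  -- horosphere.
  have first : ∀ a, inner ℝ (outwardNormal (f ζ) (X u)) (fderiv ℝ X u a) = (0 : ℝ) := by
    intro a
    have h1 := (jet a 0).velocity_eq_zero (lmax a 0)
    have h2 := (jet 0 0).velocity_eq_zero (lmax 0 0)
    simp only [map_zero, dirDeriv, inner_sub_right, inner_zero_right] at h1 h2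
    rw [inner_outwardNormal]
    have h3 : inner ℝ (X u) (fderiv ℝ X u a) / (1 - ‖X u‖ ^ 2) +
      inner ℝ (X u - (f ζ : E3)) (fderiv ℝ X u a) / ‖X u - (f ζ : E3)‖ ^ 2 = 0 := by
      linear_combination (-1 / 4) * h1 + (1 / 4) * h2
    calc _ = (1 - ‖X u‖ ^ 2) ^ 2 / 2 * (inner ℝ (X u) (fderiv ℝ X u a) / (1 - ‖X u‖ ^ 2) +
      inner ℝ (X u - (f ζ : E3)) (fderiv ℝ X u a) / ‖X u - (f ζ : E3)‖ ^ 2) := by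
          field_simp
      _ = 0 := by rw [h3, mul_zero]
  have hN : IsUnitNormal X u (outwardNormal (f ζ) (X u)) := by
    refine ⟨?_, fun a => ?_⟩
    · rw [hypMetric, inner_outwardNormal_self hD.ne']
      field_simp
    · rw [hypMetric, real_inner_comm, first, mul_zero]
  have hN0 : outwardNormal (f ζ) (X u) ≠ 0 := by
    intro h
    have := hN.1
    rw [h, hypMetric, inner_zero_left, mul_zero] at this
    exact zero_ne_one this
  have zf := fun w => hf.inner_dirDeriv w hζ1
  -- The scale gives the velocity of `x` a hyperbolic length equal to the length of the velocity of
  -- `f ζ` in the visual metric from `x`.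
  have lift : ∀ w, ∃ a, fderiv ℝ X u a =
      ((1 - ‖X u‖ ^ 2) ^ 2 / (2 * ‖X u - (f ζ : E3)‖ ^ 2)) •
        reflect (X u) (f ζ) (dirDeriv w (fun ζ => (f ζ : E3)) ζ) := by
    intro w
    refine exists_apply_eq_of_orthogonal (hX.immersion u hu) hN0 first ?_
    rw [inner_smul_right, inner_outwardNormal_reflect hD.ne' (zf w), mul_zero]
  obtain ⟨a, ha⟩ := lift 1
  obtain ⟨b, hb⟩ := lift Complex.I
  have ja := (jet a 1).acceleration_nonpos (lmax a 1)
  have jb := (jet b Complex.I).acceleration_nonpos (lmax b Complex.I)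
  rw [second_variation_eq hA.ne' hD.ne' (zf _) ha] at ja
  rw [second_variation_eq hA.ne' hD.ne' (zf _) hb] at jb
  have hII : secondFormQuad X u (outwardNormal (f ζ) (X u)) a +
      secondFormQuad X u (outwardNormal (f ζ) (X u)) b = 0 := by
    refine secondFormQuad_add_eq_zero hXd2 (hM.minimal U X hX u hu _ hN)
      (c := 4 / (1 - ‖X u‖ ^ 2) ^ 2 *
        (((1 - ‖X u‖ ^ 2) ^ 2 / (2 * ‖X u - (f ζ : E3)‖ ^ 2)) ^ 2 * l ζ)) (by positivity) ?_ ?_ ?_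
    · rw [ha, hypMetric, inner_smul_left, inner_smul_right, inner_reflect, hf.inner_one_one ζ hζ1]
      simp only [RCLike.conj_to_real]; ring
    · rw [hb, hypMetric, inner_smul_left, inner_smul_right, inner_reflect, hf.inner_I_I ζ hζ1]
      simp only [RCLike.conj_to_real]; ring
    · rw [ha, hb, hypMetric, inner_smul_left, inner_smul_right, inner_reflect,
        hf.inner_one_I ζ hζ1]
      simp
  unfold secondFormQuad at hII
  rw [hf.inner_one_one ζ hζ1] at ja
  rw [hf.inner_I_I ζ hζ1] at jb
  have hlap := congrArg (inner ℝ (X u - (f ζ : E3))) (hf.laplacian_eq hζ1)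
  have hLi := hf.liouville hζ1
  obtain ⟨e1, e2, e3, e4⟩ := inner_eq_of_dist (x := X u) (norm_eq_of_mem_sphere (f ζ))
  have hpars := hf.parseval hζ1 (X u) (X u)
  rw [inner_add_right, inner_smul_right, inner_sub_left _ _ (f ζ : E3), e2, e4] at hlap
  rw [e1, real_inner_comm (X u), real_inner_comm (X u), real_inner_comm (X u) (f ζ : E3), e2]
    at hpars
  have hζ2 : inner ℝ ζ 1 ^ 2 + inner ℝ ζ Complex.I ^ 2 = ‖ζ‖ ^ 2 := by
    rw [← Complex.normSq_eq_norm_sq, Complex.normSq_apply, Complex.inner, Complex.inner]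
    simp; ring
  simp only [norm_one, Complex.norm_I] at ja jb
  generalize inner ℝ (X u - (f ζ : E3)) (dirDeriv 1 (dirDeriv 1 _) ζ) = s₁ at *
  generalize inner ℝ (X u - (f ζ : E3)) (dirDeriv Complex.I (dirDeriv Complex.I _) ζ) = s₂ at *
  exact ahlfors_of_second_variation hD hE hl (by ring) hII hlap hLi hpars hζ2 ja jb

/-! ### The maximum principle on `M` times a disk -/

theorem one_sub_norm_sq_pos {x : E3} (hx : x ∈ H3) : 0 < 1 - ‖x‖ ^ 2 := by
  have : ‖x‖ < 1 := by simpa [H3] using hx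
  nlinarith [norm_nonneg x]

theorem norm_sub_sq_pos {x : E3} (hx : x ∈ H3) (z : S2) : 0 < ‖x - (z : E3)‖ ^ 2 := by
  have hn : ‖x‖ < 1 := by simpa [H3] using hx
  have : x ≠ (z : E3) := fun h => by
    rw [h, norm_eq_of_mem_sphere] at hn; exact lt_irrefl _ hn
  have := norm_pos_iff.2 (sub_ne_zero.2 this)
  positivity

/-- Ahlfors' inequality on a disk of radius less than one. -/
theorem factor_mul_visualMetric_le_of_lt {M : Set E3} (hM : IsMinimalSurface M) {f : ℂ → S2}
    {l : ℂ → ℝ} (hf : IsConformalParam (ball 0 1) (fun ζ => (f ζ : E3)) l)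
    (hfM : ∀ ζ ∈ ball (0 : ℂ) 1, (f ζ : E3) ∉ closure M) {r : ℝ} (hr1 : r < 1) {x : E3}
    (hx : x ∈ M) {ζ : ℂ} (hζ : ζ ∈ ball (0 : ℂ) r) :
    l ζ * visualMetric x (f ζ) * (r ^ 2 - ‖ζ‖ ^ 2) ^ 2 ≤ 4 * r ^ 2 := by
  let G : E3 × ℂ → ℝ := fun p =>
    l p.2 * ((1 - ‖p.1‖ ^ 2) / ‖p.1 - (f p.2 : E3)‖ ^ 2) ^ 2 * (r ^ 2 - ‖p.2‖ ^ 2) ^ 2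
  have hH : M ⊆ closedBall 0 1 := hM.subset.trans ball_subset_closedBall
  have hsub : closedBall (0 : ℂ) r ⊆ ball 0 1 := closedBall_subset_ball hr1
  have hcM : closure M ⊆ closedBall 0 1 := closure_minimal hH isClosed_closedBall
  have hK : IsCompact (closure M ×ˢ closedBall (0 : ℂ) r) :=
    ((isCompact_closedBall _ _).of_isClosed_subset isClosed_closure hcM).prod
      (isCompact_closedBall _ _)
  have hmaps : MapsTo Prod.snd (closure M ×ˢ closedBall (0 : ℂ) r) (ball (0 : ℂ) 1) :=
    fun p hp => hsub hp.2
  have hlc : ContinuousOn (fun p : E3 × ℂ => l p.2) (closure M ×ˢ closedBall (0 : ℂ) r) :=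
    hf.contDiffOn_factor.continuousOn.comp continuousOn_snd hmaps
  have hfc : ContinuousOn (fun p : E3 × ℂ => (f p.2 : E3)) (closure M ×ˢ closedBall (0 : ℂ) r) :=
    hf.contDiffOn.continuousOn.comp continuousOn_snd hmaps
  have hG : ContinuousOn G (closure M ×ˢ closedBall (0 : ℂ) r) := by
    refine (hlc.mul (ContinuousOn.pow (ContinuousOn.div (by fun_prop)
      ((continuousOn_fst.sub hfc).norm.pow 2) ?_) 2)).mul (by fun_prop)
    -- The denominator vanishes nowhere because `f` avoids `closure M`, including its points at
    -- infinity.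
    rintro ⟨y, w⟩ ⟨hy, hw⟩
    have : y - (f w : E3) ≠ 0 := fun h => hfM w (hsub hw) (sub_eq_zero.1 h ▸ hy)
    exact pow_ne_zero 2 (norm_ne_zero_iff.2 this)
  have hpos : ∀ y ∈ M, ∀ w ∈ ball (0 : ℂ) r, 0 < G (y, w) := by
    intro y hy w hw
    have h1 := one_sub_norm_sq_pos (hM.subset hy)
    have h2 := norm_sub_sq_pos (hM.subset hy) (f w)
    have h3 := hf.pos w (ball_subset_ball hr1.le hw)
    have h4 : 0 < r ^ 2 - ‖w‖ ^ 2 := by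
      have : ‖w‖ < r := by simpa using hw
      nlinarith [norm_nonneg w]
    positivity
  have hlog : ∀ y ∈ M, ∀ w ∈ ball (0 : ℂ) r, logRatio f l r y w = Real.log (G (y, w)) := by
    intro y hy w hw
    have h1 := one_sub_norm_sq_pos (hM.subset hy)
    have h2 := norm_sub_sq_pos (hM.subset hy) (f w)
    have h3 := hf.pos w (ball_subset_ball hr1.le hw)
    have h4 : 0 < r ^ 2 - ‖w‖ ^ 2 := by
      have : ‖w‖ < r := by simpa using hw
      nlinarith [norm_nonneg w]
    simp only [G]
    rw [Real.log_mul (by positivity) (by positivity), Real.log_mul (by positivity) (by positivity),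
      Real.log_pow, Real.log_pow, Real.log_div h1.ne' h2.ne', logRatio]
    push_cast
    ring
  obtain ⟨⟨x₀, ζ₀⟩, ⟨hx₀, hζ₀⟩, hmax⟩ :=
    hK.exists_isMaxOn ⟨(x, ζ), subset_closure hx, ball_subset_closedBall hζ⟩ hG
  have hmem : ∀ y ∈ M, ∀ w ∈ ball (0 : ℂ) r, G (y, w) ≤ G (x₀, ζ₀) := fun y hy w hw =>
    hmax ⟨subset_closure hy, ball_subset_closedBall hw⟩
  have h0 : 0 < G (x₀, ζ₀) := (hpos x hx ζ hζ).trans_le (hmem x hx ζ hζ)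
  -- The maximum is positive, while `G` vanishes for `‖x‖ = 1` and for `‖ζ‖ = r`.
  have hx₀M : x₀ ∈ M := by
    refine hM.closed ⟨hx₀, ?_⟩
    have h1 : ‖x₀‖ ≤ 1 := by simpa using hcM hx₀
    have h2 : ‖x₀‖ ≠ 1 := fun h => by simp [G, h] at h0
    simpa [H3] using lt_of_le_of_ne h1 h2
  have hζ₀b : ζ₀ ∈ ball (0 : ℂ) r := by
    have h1 : ‖ζ₀‖ ≤ r := by simpa using hζ₀
    have h2 : ‖ζ₀‖ ≠ r := fun h => by simp [G, h] at h0
    simpa using lt_of_le_of_ne h1 h2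
  have hc := contact_inequality hM hf hr1.le hx₀M hζ₀b fun y hy w hw => by
    rw [hlog y hy w hw, hlog x₀ hx₀M ζ₀ hζ₀b]
    exact Real.log_le_log (hpos y hy w hw) (hmem y hy w hw)
  exact (hmem x hx ζ hζ).trans hc

theorem factor_mul_visualMetric_le {M : Set E3} (hM : IsMinimalSurface M) {f : ℂ → S2}
    {l : ℂ → ℝ} (hf : IsConformalParam (ball 0 1) (fun ζ => (f ζ : E3)) l)
    (hfM : ∀ ζ ∈ ball (0 : ℂ) 1, (f ζ : E3) ∉ closure M) {x : E3}
    (hx : x ∈ M) {ζ : ℂ} (hζ : ζ ∈ ball (0 : ℂ) 1) :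
    l ζ * visualMetric x (f ζ) * (1 - ‖ζ‖ ^ 2) ^ 2 ≤ 4 := by
  have hζn : ‖ζ‖ < 1 := by simpa using hζ
  have h1 : Filter.Tendsto (fun r : ℝ => l ζ * visualMetric x (f ζ) * (r ^ 2 - ‖ζ‖ ^ 2) ^ 2)
      (𝓝[<] 1) (𝓝 (l ζ * visualMetric x (f ζ) * (1 ^ 2 - ‖ζ‖ ^ 2) ^ 2)) :=
    Continuous.continuousWithinAt (by fun_prop)
  have h2 : Filter.Tendsto (fun r : ℝ => 4 * r ^ 2) (𝓝[<] 1) (𝓝 (4 * 1 ^ 2)) :=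
    Continuous.continuousWithinAt (by fun_prop)
  have h := le_of_tendsto_of_tendsto h1 h2 (by
    filter_upwards [Ioo_mem_nhdsLT hζn] with r hr
    exact factor_mul_visualMetric_le_of_lt hM hf hfM hr.2 hx (by simpa using hr.1))
  simpa using h

/-- The Poincaré metric dominates the visual metrics from the points of a minimal surface whose
ideal boundary does not meet the domain. -/
theorem visualMetric_le_of_isPoincareMetric {M : Set E3} (hM : IsMinimalSurface M) {Ω : Set S2}
    (hΩ : ∀ z ∈ Ω, (z : E3) ∉ closure M) {ρ : S2 → ℝ} (hρ : IsPoincareMetric Ω ρ) {x : E3}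
    (hx : x ∈ M) {z : S2} (hz : z ∈ Ω) : visualMetric x z ≤ ρ z := by
  obtain ⟨f, hf, -, himg, hconf⟩ := hρ
  have hsim : ∀ ζ ∈ ball (0 : ℂ) 1, 0 < ‖fderiv ℝ (fun ζ => (f ζ : E3)) ζ‖ ^ 2 ∧
      ∀ u v : ℂ, inner ℝ (fderiv ℝ (fun ζ => (f ζ : E3)) ζ u)
        (fderiv ℝ (fun ζ => (f ζ : E3)) ζ v) =
        ‖fderiv ℝ (fun ζ => (f ζ : E3)) ζ‖ ^ 2 * (inner ℝ u v : ℝ) := by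
    intro ζ hζ
    obtain ⟨c, hc, h⟩ := conformalAt_iff'.1 (hconf ζ hζ).1
    -- A conformal derivative is a homothety, so its operator norm is the scale factor.
    have hn : ‖fderiv ℝ (fun ζ => (f ζ : E3)) ζ‖ = √c := by
      refine ContinuousLinearMap.homothety_norm _ fun u => ?_
      have h1 := h u u
      rw [real_inner_self_eq_norm_sq, real_inner_self_eq_norm_sq] at h1
      rw [← Real.sqrt_sq (norm_nonneg (fderiv ℝ (fun ζ => (f ζ : E3)) ζ u)), h1,
        Real.sqrt_mul hc.le, Real.sqrt_sq (norm_nonneg u)]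
    rw [hn, Real.sq_sqrt hc.le]
    exact ⟨hc, h⟩
  have hF : IsConformalParam (ball 0 1) (fun ζ => (f ζ : E3))
      (fun ζ => ‖fderiv ℝ (fun ζ => (f ζ : E3)) ζ‖ ^ 2) := by
    refine ⟨isOpen_ball, hf, fun ζ _ => ?_, fun ζ hζ => (hsim ζ hζ).1, fun ζ hζ => ?_,
      fun ζ hζ => ?_, fun ζ hζ => ?_⟩
    · rw [real_inner_self_eq_norm_sq, norm_eq_of_mem_sphere]; norm_num
    · rw [dirDeriv, (hsim ζ hζ).2, real_inner_self_eq_norm_sq, norm_one]; ring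
    · rw [dirDeriv, (hsim ζ hζ).2, real_inner_self_eq_norm_sq, Complex.norm_I]; ring
    · rw [dirDeriv, dirDeriv, (hsim ζ hζ).2, Complex.inner]; simp
  rw [← himg] at hz
  obtain ⟨ζ, hζ, rfl⟩ := hz
  have hζn : 0 < 1 - ‖ζ‖ ^ 2 := by
    have : ‖ζ‖ < 1 := by simpa using hζ
    nlinarith [norm_nonneg ζ]
  have h1 := factor_mul_visualMetric_le hM hF
    (fun w hw => hΩ _ (himg ▸ mem_image_of_mem f hw)) hx hζ
  rw [← le_div_iff₀ (by positivity), ← (hconf ζ hζ).2, mul_comm] at h1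
  exact le_of_mul_le_mul_right h1 (hsim ζ hζ).1

/-! ### From horoballs to the component of the complement -/

/-- Visual metrics increase along the Euclidean segment towards a point at infinity. -/
theorem visualMetric_lt_lineMap {y : E3} (hy : y ∈ H3) (z : S2) {s : ℝ} (hs : s ∈ Ioo (0 : ℝ) 1) :
    AffineMap.lineMap y (z : E3) s ∈ H3 ∧
      visualMetric y z < visualMetric (AffineMap.lineMap y (z : E3) s) z := by
  obtain ⟨hs0, hs1⟩ := hs
  have hA := one_sub_norm_sq_pos hy
  have hD := norm_sub_sq_pos hy z
  obtain ⟨e1, e2, -, e4⟩ := inner_eq_of_dist (x := y) (norm_eq_of_mem_sphere z)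
  have hp : AffineMap.lineMap y (z : E3) s = (1 - s) • y + s • (z : E3) :=
    AffineMap.lineMap_apply_module _ _ _
  -- With `A = 1 - |y|²` and `D = |y - z|²`, the ratio `A / D` becomes `(A + sD) / ((1 - s)D)` at
  -- parameter `s`.
  have hA' : 1 - ‖AffineMap.lineMap y (z : E3) s‖ ^ 2 =
      (1 - s) * (1 - ‖y‖ ^ 2 + s * ‖y - (z : E3)‖ ^ 2) := by
    rw [hp, norm_add_sq_real, norm_smul, norm_smul, norm_eq_of_mem_sphere, inner_smul_left,
      inner_smul_right, e2, mul_pow, mul_pow, Real.norm_eq_abs, Real.norm_eq_abs, sq_abs, sq_abs]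
    simp only [RCLike.conj_to_real]
    ring
  have hD' : ‖AffineMap.lineMap y (z : E3) s - (z : E3)‖ ^ 2 =
      (1 - s) ^ 2 * ‖y - (z : E3)‖ ^ 2 := by
    have : (1 - s) • y + s • (z : E3) - z = (1 - s) • (y - (z : E3)) := by module
    rw [hp, this, norm_smul, mul_pow, Real.norm_eq_abs, sq_abs]
  have h1s : 0 < 1 - s := by linarith
  constructor
  · have : 0 < 1 - ‖AffineMap.lineMap y (z : E3) s‖ ^ 2 := by rw [hA']; positivity
    have h2 : ‖AffineMap.lineMap y (z : E3) s‖ < 1 := by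
      nlinarith [norm_nonneg (AffineMap.lineMap y (z : E3) s)]
    simpa [H3] using h2
  · unfold visualMetric
    rw [hA', hD']
    refine pow_lt_pow_left₀ ?_ (by positivity) (by norm_num)
    rw [div_lt_div_iff₀ hD (by positivity)]
    have : (1 - ‖y‖ ^ 2) * (1 - s) < 1 - ‖y‖ ^ 2 + s * ‖y - (z : E3)‖ ^ 2 := by nlinarith
    nlinarith [mul_lt_mul_of_pos_left this (mul_pos h1s hD)]

/-- If the horoball at `z` bounded by the horosphere through `y` misses `M`, and `z` is an
ideal point of the component `C` but not of `M`, then `y` belongs to the closure of `C`. -/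
theorem mem_closure_of_visualMetric_le {M C : Set E3} (hC : IsComponentOf C (H3 \ M)) {z : S2}
    (hzM : (z : E3) ∉ closure M) (hzC : (z : E3) ∈ closure C) {y : E3} (hy : y ∈ H3)
    (h : ∀ x ∈ M, visualMetric x z ≤ visualMetric y z) : y ∈ closure C := by
  obtain ⟨p, hp, rfl⟩ := hC
  let g : ℝ → E3 := fun s => AffineMap.lineMap y (z : E3) s
  have hg : Continuous g := AffineMap.lineMap_continuous
  have hseg : g '' Ioo 0 1 ⊆ H3 \ M := by
    rintro _ ⟨s, hs, rfl⟩
    have := visualMetric_lt_lineMap hy z hs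
    exact ⟨this.1, fun hM => (h _ hM).not_gt this.2⟩
  obtain ⟨ε, hε, hball⟩ := Metric.isOpen_iff.1 isClosed_closure.isOpen_compl (z : E3) hzM
  have hnb : ball (z : E3) ε ∩ H3 ⊆ H3 \ M := fun x hx =>
    ⟨hx.2, fun hM => hball hx.1 (subset_closure hM)⟩
  -- Near `z` the part of `H3` is convex and misses `M`, so it lies in a single component, which is
  -- `C` since `C` accumulates at `z`.
  have hnbc : IsPreconnected (ball (z : E3) ε ∩ H3) :=
    ((convex_ball _ _).inter (convex_ball _ _)).isPreconnected
  obtain ⟨q, hqC, hq⟩ : ∃ q ∈ connectedComponentIn (H3 \ M) p, q ∈ ball (z : E3) ε := by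
    obtain ⟨q, hq, hqC⟩ := mem_closure_iff.1 hzC _ isOpen_ball (mem_ball_self hε)
    exact ⟨q, hqC, hq⟩
  have hqH : q ∈ H3 := (connectedComponentIn_subset _ _ hqC).1
  have hnbC : ball (z : E3) ε ∩ H3 ⊆ connectedComponentIn (H3 \ M) p := by
    rw [connectedComponentIn_eq hqC]
    exact hnbc.subset_connectedComponentIn ⟨hq, hqH⟩ hnb
  have hg1 : g 1 = z := AffineMap.lineMap_apply_one _ _
  have hg0 : g 0 = y := AffineMap.lineMap_apply_zero _ _
  obtain ⟨s, hs, hsb⟩ : ∃ s ∈ Ioo (0 : ℝ) 1, g s ∈ ball (z : E3) ε := by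
    have h1 : ∀ᶠ s in 𝓝[<] (1 : ℝ), g s ∈ ball (z : E3) ε :=
      (hg.tendsto 1).mono_left nhdsWithin_le_nhds |>.eventually
        (isOpen_ball.mem_nhds (by rw [hg1]; exact mem_ball_self hε))
    obtain ⟨s, hs, hs'⟩ := (h1.and (Ioo_mem_nhdsLT zero_lt_one)).exists
    exact ⟨s, hs', hs⟩
  have hsC : g s ∈ connectedComponentIn (H3 \ M) p := hnbC ⟨hsb, (hseg ⟨s, hs, rfl⟩).1⟩
  have hsegC : g '' Ioo 0 1 ⊆ connectedComponentIn (H3 \ M) p := by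
    rw [connectedComponentIn_eq hsC]
    exact (isPreconnected_Ioo.image g hg.continuousOn).subset_connectedComponentIn
      ⟨s, hs, rfl⟩ hseg
  -- The point `y` may itself lie on `M`, so it is reached only as a limit of the open segment.
  have h0 : (0 : ℝ) ∈ closure (Ioo (0 : ℝ) 1) := by
    rw [closure_Ioo zero_ne_one]; simp
  rw [← hg0]
  exact closure_mono hsegC (image_closure_subset_closure_image hg ⟨0, h0, rfl⟩)

end EpsteinPoincare

/-- At a point of contact the comparison with the Poincaré metric uses only that the mean curvature
vanishes, so the bound `hk` on the principal curvatures is not needed. -/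
theorem mainTheorem11
    (γ Ω : Set EpsteinPoincare.S2) (hγ : EpsteinPoincare.IsJordanCurve γ)
    (hΩ : EpsteinPoincare.IsComponentOf Ω γᶜ)
    (M : Set EpsteinPoincare.E3) (hM : EpsteinPoincare.IsMinimalSurface M)
    (hMγ : EpsteinPoincare.idealBoundary M = γ)
    (hk : ∀ p ∈ M, ∀ k : ℝ, EpsteinPoincare.IsPrincipalCurvature M p k → -1 < k ∧ k < 1)
    (C : Set EpsteinPoincare.E3) (hC : EpsteinPoincare.IsComponentOf C (EpsteinPoincare.H3 \ M))
    (hCΩ : Ω ⊆ EpsteinPoincare.idealBoundary C)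
    (t : ℝ) (ht : 0 ≤ t) :
    EpsteinPoincare.epsteinPoincareSurface Ω t ⊆ closure C ∩ EpsteinPoincare.H3 := by
  rintro _ ⟨ρ, Ep, hρ, hEp, z, hz, rfl⟩
  obtain ⟨hy, hyv⟩ := hEp.mem_horosphere z hz
  have hΩM : ∀ w ∈ Ω, (w : EpsteinPoincare.E3) ∉ closure M := by
    obtain ⟨w₀, -, rfl⟩ := hΩ
    intro w hw hwM
    exact connectedComponentIn_subset _ _ hw (hMγ ▸ hwM)
  have hle : ∀ x ∈ M, EpsteinPoincare.visualMetric x z ≤ ρ z := fun x hx =>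
    EpsteinPoincare.visualMetric_le_of_isPoincareMetric hM hΩM hρ hx hz
  refine ⟨EpsteinPoincare.mem_closure_of_visualMetric_le hC (hΩM z hz) (hCΩ hz) hy
    fun x hx => ?_, hy⟩
  -- `ρ z` dominates a visual metric, which is a square; so multiplying by `e^{2t} ≥ 1` does not
  -- decrease it.
  have h0 : 0 ≤ ρ z := le_trans (sq_nonneg _) (hle x hx)
  rw [hyv]
  exact (hle x hx).trans (le_mul_of_one_le_left h0 (Real.one_le_exp (by linarith)))
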